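/- Let $\mathcal H$ be a complex separable Hilbert space, let $n\ge 1$ be an integer and let $T$ be a bounded linear operator on $\mathcal H$ that is an $n$-hypercontraction, i.e. $\sum_{j=0}^{k}(-1)^{j}\binom{k}{j}(T^{*})^{j}T^{j}\ge 0$ for every $1\le k\le n$. Let $\mathcal M\subseteq\mathcal H$ be a closed subspace invariant under $T$, and write $T_1=T|_{\mathcal M}$. Suppose that: (i) $T_1\in B_1(\mathbb D)$, where $\mathbb D$ is the open unit disc; that is, for every $\omega\in\mathbb D$ the operator $T_1-\omega$ is surjective on $\mathcal M$ and $\dim\ker(T_1-\omega)=1$, and the closed linear span of $\bigcup_{\omega\in\mathbb D}\ker(T_1-\omega)$ is $\mathcal M$; (ii) the curvature of $T_1$ is $\mathcal K_{T_1}(\omega)=\dfrac{-n}{(1-|\omega|^2)^2}$ for all $\omega\in\mathbb D$. Here $\mathcal K_{T_1}=-\frac{\partial}{\partial\bar\omega}\bigl(h^{-1}\frac{\partial h}{\partial\omega}\bigr)$ with $h(\omega)=\|\gamma(\omega)\|^2$, where $\gamma$ is any nowhere vanishing holomorphic section, over an open subset of $\mathbb D$, of the bundle with fibres $\ker(T_1-\omega)$;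 such sections exist near every point, and the value does not depend on the choice of $\gamma$. Then the corner $T_{1,2}=P_{\mathcal M}T|_{\mathcal M^{\perp}}$ vanishes, so $\mathcal M$ reduces $T$ (both $\mathcal M$ and $\mathcal M^\perp$ are invariant under $T$). In particular, if $\mathcal M\ne\mathcal H$, then $T$ is reducible, i.e. there is a closed subspace $\mathcal N$ with $\{0\}\ne\mathcal N\ne\mathcal H$ that reduces $T$. -/

import Mathlib

open scoped InnerProductSpace

/-- `T` is an `n`-hypercontraction:
`∑_{j=0}^{k} (-1)^j (k choose j) (T*)^j T^j ≥ 0` for every `1 ≤ k ≤ n`. -/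
def IsHypercontraction {H : Type*} [NormedAddCommGroup H] [InnerProductSpace ℂ H] [CompleteSpace H]
    (n : ℕ) (T : H →L[ℂ] H) : Prop :=
  ∀ k : ℕ, 1 ≤ k → k ≤ n →
    (∑ j ∈ Finset.range (k + 1),
      ((-1 : ℂ) ^ j * (k.choose j : ℂ)) • (ContinuousLinearMap.adjoint T ^ j * T ^ j)).IsPositive

/-- The eigenspace `ker (T - ω)`. -/
def eigenKer {E : Type*} [NormedAddCommGroup E] [InnerProductSpace ℂ E]
    (T : E →L[ℂ] E) (ω : ℂ) : Submodule ℂ E :=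
  LinearMap.ker ((T - ω • ContinuousLinearMap.id ℂ E : E →L[ℂ] E) : E →ₗ[ℂ] E)

/-- The Cowen-Douglas class `B_m(Ω)`, for a bounded open set `Ω ⊆ ℂ`. -/
structure IsCowenDouglas {E : Type*} [NormedAddCommGroup E] [InnerProductSpace ℂ E]
    (m : ℕ) (Ω : Set ℂ) (T : E →L[ℂ] E) : Prop where
  surjective : ∀ ω ∈ Ω, Function.Surjective (T - ω • ContinuousLinearMap.id ℂ E : E →L[ℂ] E)
  rank_ker : ∀ ω ∈ Ω, Module.rank ℂ (eigenKer T ω) = m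
  span_ker : (⨆ ω ∈ Ω, eigenKer T ω).topologicalClosure = ⊤

/-- The Wirtinger derivative `∂f/∂ω = (∂f/∂x - i ∂f/∂y) / 2`. -/
noncomputable def wirtingerD (f : ℂ → ℂ) (ω : ℂ) : ℂ :=
  (fderiv ℝ f ω 1 - Complex.I * fderiv ℝ f ω Complex.I) / 2

/-- The Wirtinger derivative `∂f/∂ω̄ = (∂f/∂x + i ∂f/∂y) / 2`. -/
noncomputable def wirtingerDBar (f : ℂ → ℂ) (ω : ℂ) : ℂ :=
  (fderiv ℝ f ω 1 + Complex.I * fderiv ℝ f ω Complex.I) / 2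

/-- `γ` is a nowhere vanishing holomorphic section over `U` of the eigenvector bundle
`{(x, ω) | x ∈ ker (T - ω)}`. -/
structure IsHolomorphicSection {E : Type*} [NormedAddCommGroup E] [InnerProductSpace ℂ E]
    (T : E →L[ℂ] E) (U : Set ℂ) (γ : ℂ → E) : Prop where
  holomorphic : DifferentiableOn ℂ γ U
  ne_zero : ∀ ω ∈ U, γ ω ≠ 0
  mem_ker : ∀ ω ∈ U, γ ω ∈ eigenKer T ω

/-- The metric `h(ω) = ⟨γ(ω), γ(ω)⟩` given by a section of a line bundle. -/
noncomputable def sectionMetric {E : Type*} [NormedAddCommGroup E] [InnerProductSpace ℂ E]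
    (γ : ℂ → E) (ω : ℂ) : ℂ := ⟪γ ω, γ ω⟫_ℂ

/-- The curvature `-∂/∂ω̄ (h⁻¹ ∂h/∂ω)` computed from the section `γ`. -/
noncomputable def sectionCurvature {E : Type*} [NormedAddCommGroup E] [InnerProductSpace ℂ E]
    (γ : ℂ → E) (ω : ℂ) : ℂ :=
  -wirtingerDBar (fun z => (sectionMetric γ z)⁻¹ * wirtingerD (sectionMetric γ) z) ω

/-- `κ` is the curvature function `𝒦_T` on `Ω` of the operator `T` in `B_1(Ω)`: it is the curvature
computed from any nowhere vanishing holomorphic section of the eigenvector bundle of `T` over any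
open subset of `Ω`. Such sections exist near every point of `Ω`
(`IsCowenDouglas.exists_isHolomorphicSection`), so `κ` is determined on `Ω`. -/
def IsCurvatureOn {E : Type*} [NormedAddCommGroup E] [InnerProductSpace ℂ E]
    (T : E →L[ℂ] E) (Ω : Set ℂ) (κ : ℂ → ℂ) : Prop :=
  ∀ (U : Set ℂ) (γ : ℂ → E), IsOpen U → U ⊆ Ω → IsHolomorphicSection T U γ →
    ∀ ω ∈ U, sectionCurvature γ ω = κ ω

/-- The closed subspace `N` reduces `T`: both `N` and `Nᗮ` are invariant under `T`. -/
def Reduces {H : Type*} [NormedAddCommGroup H] [InnerProductSpace ℂ H]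
    (T : H →L[ℂ] H) (N : Submodule ℂ H) : Prop :=
  IsClosed (N : Set H) ∧ Set.MapsTo T N N ∧ Set.MapsTo T Nᗮ Nᗮ

/-- `T` is reducible: it has a nontrivial reducing subspace. -/
def IsReducible {H : Type*} [NormedAddCommGroup H] [InnerProductSpace ℂ H]
    (T : H →L[ℂ] H) : Prop :=
  ∃ N : Submodule ℂ H, N ≠ ⊥ ∧ N ≠ ⊤ ∧ Reduces T N

/-- Near every point of `Ω`, the eigenvector bundle of an operator in `B_1(Ω)` has a nowhere
vanishing holomorphic section. -/
theorem IsCowenDouglas.exists_isHolomorphicSection {E : Type*} [NormedAddCommGroup E]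
    [InnerProductSpace ℂ E] [CompleteSpace E] {Ω : Set ℂ} {T : E →L[ℂ] E} (hΩ : IsOpen Ω)
    (hT : IsCowenDouglas 1 Ω T) {ω₀ : ℂ} (hω₀ : ω₀ ∈ Ω) :
    ∃ (U : Set ℂ) (γ : ℂ → E), IsOpen U ∧ U ⊆ Ω ∧ ω₀ ∈ U ∧ IsHolomorphicSection T U γ := by
  set S : E →L[ℂ] E := T - ω₀ • ContinuousLinearMap.id ℂ E with hS
  have hsurj : Function.Surjective S := hT.surjective ω₀ hω₀
  obtain ⟨x₀, hx₀, hx₀'⟩ : ∃ x ∈ eigenKer T ω₀, x ≠ 0 := by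
    apply Submodule.exists_mem_ne_zero_of_ne_bot
    intro h
    have := hT.rank_ker ω₀ hω₀
    rw [h] at this
    simp at this
  have hSx₀ : S x₀ = 0 := hx₀
  -- a bounded right inverse of `S`
  obtain ⟨R, hR⟩ : ∃ R : E →L[ℂ] E, ∀ x, S (R x) = x := by
    have : CompleteSpace S.ker := S.isClosed_ker.completeSpace_coe
    let S' : S.kerᗮ →L[ℂ] E := S.comp (S.kerᗮ).subtypeL
    have hker : S'.ker = ⊥ := by
      rw [LinearMap.ker_eq_bot']
      intro x hx
      have h1 : (x : E) ∈ S.ker := hx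
      have h2 := x.2 _ h1
      exact Subtype.ext (inner_self_eq_zero.1 h2)
    have hrange : S'.range = ⊤ := by
      rw [LinearMap.range_eq_top]
      intro y
      obtain ⟨x, rfl⟩ := hsurj y
      obtain ⟨a, ha, b, hb, rfl⟩ := S.ker.exists_add_mem_mem_orthogonal x
      refine ⟨⟨b, hb⟩, ?_⟩
      have : S a = 0 := ha
      simp [S', this]
    let e := ContinuousLinearEquiv.ofBijective S' hker hrange
    exact ⟨(S.kerᗮ).subtypeL.comp (e.symm : E →L[ℂ] S.kerᗮ), fun x => e.apply_symm_apply x⟩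
  let A : ℂ → (E →L[ℂ] E) := fun ω => 1 - (ω - ω₀) • R
  have hA : Differentiable ℂ A := by fun_prop
  let U : Set ℂ := Ω ∩ A ⁻¹' {a | IsUnit a}
  refine ⟨U, fun ω => Ring.inverse (A ω) x₀, hΩ.inter (Units.isOpen.preimage hA.continuous),
    Set.inter_subset_left, ⟨hω₀, by simp [A]⟩, ?_, ?_, ?_⟩
  · intro ω hω
    obtain ⟨u, hu⟩ : IsUnit (A ω) := hω.2
    have h1 : DifferentiableAt ℂ Ring.inverse (A ω) := hu ▸ differentiableAt_inverse u.isUnit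
    have h2 : DifferentiableAt ℂ (fun z => Ring.inverse (A z)) ω := h1.comp ω (hA ω)
    exact (h2.clm_apply (differentiableAt_const x₀)).differentiableWithinAt
  · intro ω hω h0
    have h1 : A ω * Ring.inverse (A ω) = 1 := Ring.mul_inverse_cancel _ hω.2
    have h2 := congrArg (fun B : E →L[ℂ] E => B x₀) h1
    simp only [mul_apply_eq_comp, one_apply_eq_self] at h2
    rw [h0, map_zero] at h2
    exact hx₀' h2.symm
  · intro ω hω
    have h1 : A ω * Ring.inverse (A ω) = 1 := Ring.mul_inverse_cancel _ hω.2
    have h2 := congrArg (fun B : E →L[ℂ] E => S (B x₀)) h1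
    simp only [mul_apply_eq_comp, one_apply_eq_self, hSx₀] at h2
    change (T - ω • ContinuousLinearMap.id ℂ E) (Ring.inverse (A ω) x₀) = 0
    simp only [A, sub_apply, one_apply_eq_self,
      smul_apply, map_sub, map_smul, hR] at h2
    simp only [hS, sub_apply, smul_apply,
      ContinuousLinearMap.id_apply] at h2 ⊢
    rw [← h2]
    module

/-! Let D be the defect operator of order n, and γ(ω) a holomorphic section of eigenvectors. The
binomial theorem gives Dγ(ω) = (1 - ωT*)ⁿγ(ω), so ⟪γ, Dγ⟫ = (1 - |ω|²)ⁿ‖γ‖². Since D ≥ 0, write D =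
S*S: then Sγ is holomorphic with this metric, and the curvature hypothesis says exactly that its
curvature is zero (`sectionCurvature_eq_zero_of_metric`). Zero curvature is equality in
Cauchy–Schwarz for Sγ and its derivative, so Sγ stays locally in a line; by connectedness of the
disc all Dγ(ω) lie in one line (`defectOp_apply_mem_span`). At ω = 0, D fixes e ∈ ker T₁, so the
line is ℂe and γ(ω) is a nonzero multiple of (1 - ωT*)⁻ⁿe. Hence M is the closed span of the vectors
T*ᵏe and is invariant under T* (`mapsTo_adjoint_of_isCurvatureOn`). -/

open Topology ComplexConjugate

/-! ### Wirtinger calculus. -/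

/-- The real-differentiable function `f` has Wirtinger derivatives `a = ∂f/∂z` and `b = ∂f/∂z̄`. -/
def HasWirtingerDerivAt (f : ℂ → ℂ) (a b z : ℂ) : Prop :=
  HasFDerivAt f (a • (1 : ℂ →L[ℝ] ℂ) + b • (Complex.conjCLE : ℂ →L[ℝ] ℂ)) z

namespace HasWirtingerDerivAt

variable {f g : ℂ → ℂ} {a b a' b' z : ℂ}

theorem wirtingerD_eq (h : HasWirtingerDerivAt f a b z) : wirtingerD f z = a := by
  unfold wirtingerD
  rw [HasFDerivAt.fderiv h]
  simp
  linear_combination (b / 2 - a / 2) * Complex.I_sq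

theorem wirtingerDBar_eq (h : HasWirtingerDerivAt f a b z) : wirtingerDBar f z = b := by
  unfold wirtingerDBar
  rw [HasFDerivAt.fderiv h]
  simp
  linear_combination (a / 2 - b / 2) * Complex.I_sq

theorem congr_of_eventuallyEq (h : HasWirtingerDerivAt f a b z) (hg : g =ᶠ[𝓝 z] f) :
    HasWirtingerDerivAt g a b z :=
  HasFDerivAt.congr_of_eventuallyEq h hg

theorem congr_right (h : HasWirtingerDerivAt f a b z) (hb : b = b') :
    HasWirtingerDerivAt f a b' z :=
  hb ▸ h

theorem sub (hf : HasWirtingerDerivAt f a b z) (hg : HasWirtingerDerivAt g a' b' z) :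
    HasWirtingerDerivAt (fun w => f w - g w) (a - a') (b - b') z := by
  refine (HasFDerivAt.sub hf hg).congr_fderiv ?_
  refine ContinuousLinearMap.ext fun v => ?_
  simp
  ring

theorem mul (hf : HasWirtingerDerivAt f a b z) (hg : HasWirtingerDerivAt g a' b' z) :
    HasWirtingerDerivAt (fun w => f w * g w) (a * g z + f z * a') (b * g z + f z * b') z := by
  refine (HasFDerivAt.mul hf hg).congr_fderiv ?_
  refine ContinuousLinearMap.ext fun v => ?_
  simp
  ring

theorem comp_left {φ : ℂ → ℂ} {φ' : ℂ} (hφ : HasDerivAt φ φ' (f z))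
    (hf : HasWirtingerDerivAt f a b z) :
    HasWirtingerDerivAt (fun w => φ (f w)) (φ' * a) (φ' * b) z := by
  refine ((hφ.hasFDerivAt.restrictScalars ℝ).comp z hf).congr_fderiv ?_
  refine ContinuousLinearMap.ext fun v => ?_
  simp
  ring

theorem const (c : ℂ) : HasWirtingerDerivAt (fun _ => c) 0 0 z := by
  refine (hasFDerivAt_const c z).congr_fderiv ?_
  refine ContinuousLinearMap.ext fun v => ?_
  simp

theorem star : HasWirtingerDerivAt (fun w => conj w) 0 1 z := by
  refine (Complex.conjCLE : ℂ →L[ℝ] ℂ).hasFDerivAt.congr_fderiv ?_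
  refine ContinuousLinearMap.ext fun v => ?_
  simp

theorem id : HasWirtingerDerivAt (fun w => w) 1 0 z := by
  refine (hasFDerivAt_id z).congr_fderiv ?_
  refine ContinuousLinearMap.ext fun v => ?_
  simp

/-- The inner product is conjugate-linear in its first slot, so `F` feeds only the z̄-derivative and
`G` only the z-derivative. -/
theorem inner {E : Type*} [NormedAddCommGroup E] [InnerProductSpace ℂ E] {F G : ℂ → E} {F' G' : E}
    (hF : HasDerivAt F F' z) (hG : HasDerivAt G G' z) :
    HasWirtingerDerivAt (fun w => ⟪F w, G w⟫_ℂ) ⟪F z, G'⟫_ℂ ⟪F', G z⟫_ℂ z := by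
  refine (HasFDerivAt.inner ℂ (hF.hasFDerivAt.restrictScalars ℝ)
    (hG.hasFDerivAt.restrictScalars ℝ)).congr_fderiv ?_
  refine ContinuousLinearMap.ext fun v => ?_
  simp [inner_smul_left, inner_smul_right, mul_comm]

end HasWirtingerDerivAt

/-! ### Curvature of holomorphic vector-valued functions. -/

section Curvature

variable {E : Type*} [NormedAddCommGroup E] [InnerProductSpace ℂ E]

/-- The `z̄`-derivative of `⟪F, F'⟫ / ⟪F, F⟫` is the Gram determinant of `F, F'` over `‖F‖⁴`. -/
theorem hasWirtingerDerivAt_logDeriv_metric [CompleteSpace E] {U : Set ℂ} (hU : IsOpen U)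
    {F : ℂ → E} (hF : DifferentiableOn ℂ F U) {z : ℂ} (hz : z ∈ U) (h0 : F z ≠ 0) :
    ∃ a, HasWirtingerDerivAt (fun w => (⟪F w, F w⟫_ℂ)⁻¹ * ⟪F w, deriv F w⟫_ℂ) a
      ((⟪F z, F z⟫_ℂ * ⟪deriv F z, deriv F z⟫_ℂ - ⟪F z, deriv F z⟫_ℂ * ⟪deriv F z, F z⟫_ℂ) /
        ⟪F z, F z⟫_ℂ ^ 2) z := by
  have h0' : ⟪F z, F z⟫_ℂ ≠ 0 := inner_self_ne_zero.2 h0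
  have h1 : HasDerivAt F (deriv F z) z := (hF.differentiableAt (hU.mem_nhds hz)).hasDerivAt
  have h2 : HasDerivAt (deriv F) (deriv (deriv F) z) z :=
    ((hF.deriv hU).differentiableAt (hU.mem_nhds hz)).hasDerivAt
  have h3 := (HasWirtingerDerivAt.comp_left (hasDerivAt_inv h0')
    (HasWirtingerDerivAt.inner h1 h1)).mul (HasWirtingerDerivAt.inner h1 h2)
  -- The second derivative of `F` enters only the z-derivative `a`, which is left unspecified.
  refine ⟨_, h3.congr_right ?_⟩
  field_simp
  ring

theorem wirtingerD_sectionMetric {U : Set ℂ} (hU : IsOpen U)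
    {F : ℂ → E} (hF : DifferentiableOn ℂ F U) {z : ℂ} (hz : z ∈ U) :
    wirtingerD (sectionMetric F) z = ⟪F z, deriv F z⟫_ℂ := by
  have h1 : HasDerivAt F (deriv F z) z := (hF.differentiableAt (hU.mem_nhds hz)).hasDerivAt
  exact (HasWirtingerDerivAt.inner h1 h1).wirtingerD_eq

theorem sectionCurvature_eq [CompleteSpace E] {U : Set ℂ} (hU : IsOpen U)
    {F : ℂ → E} (hF : DifferentiableOn ℂ F U) {z : ℂ} (hz : z ∈ U) (h0 : F z ≠ 0) :
    sectionCurvature F z =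
      -((⟪F z, F z⟫_ℂ * ⟪deriv F z, deriv F z⟫_ℂ - ⟪F z, deriv F z⟫_ℂ * ⟪deriv F z, F z⟫_ℂ) /
        ⟪F z, F z⟫_ℂ ^ 2) := by
  obtain ⟨a, ha⟩ := hasWirtingerDerivAt_logDeriv_metric hU hF hz h0
  unfold sectionCurvature
  congr 1
  refine (ha.congr_of_eventuallyEq ?_).wirtingerDBar_eq
  filter_upwards [hU.mem_nhds hz] with w hw
  rw [wirtingerD_sectionMetric hU hF hw, sectionMetric]

theorem hasWirtingerDerivAt_one_sub_mul_conj (z : ℂ) :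
    HasWirtingerDerivAt (fun w => 1 - w * conj w) (-conj z) (-z) z := by
  convert (HasWirtingerDerivAt.const 1).sub
    (HasWirtingerDerivAt.id.mul HasWirtingerDerivAt.star) using 1 <;> simp

theorem one_sub_mul_conj_ne_zero {z : ℂ} (hz : z ∈ Metric.ball (0 : ℂ) 1) :
    1 - z * conj z ≠ 0 := by
  have h : ‖z‖ < 1 := by simpa using hz
  rw [Complex.mul_conj, Complex.normSq_eq_norm_sq]
  norm_cast
  nlinarith [norm_nonneg z]

variable {E' : Type*} [NormedAddCommGroup E'] [InnerProductSpace ℂ E']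

/-- If multiplication of the metric of `γ` by `(1 - |z|²)ⁿ` gives the metric of `Φ`, and `γ` has the
curvature `-n / (1 - |z|²)²`, then the curvature of `Φ` vanishes. -/
theorem sectionCurvature_eq_zero_of_metric [CompleteSpace E] [CompleteSpace E'] {n : ℕ}
    {U : Set ℂ} (hU : IsOpen U) (hU1 : U ⊆ Metric.ball 0 1) {γ : ℂ → E} {Φ : ℂ → E'}
    (hγ : DifferentiableOn ℂ γ U) (hγ0 : ∀ z ∈ U, γ z ≠ 0)
    (hΦ : DifferentiableOn ℂ Φ U)
    (h : ∀ z ∈ U, ⟪Φ z, Φ z⟫_ℂ = (1 - z * conj z) ^ n * ⟪γ z, γ z⟫_ℂ)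
    (hK : ∀ z ∈ U, sectionCurvature γ z = -(n : ℂ) / (1 - (‖z‖ : ℂ) ^ 2) ^ 2)
    {z : ℂ} (hz : z ∈ U) : sectionCurvature Φ z = 0 := by
  -- This is ∂ applied to log‖Φ‖² = log‖γ‖² + n log(1 - |w|²).
  have hlog : ∀ w ∈ U, (⟪Φ w, Φ w⟫_ℂ)⁻¹ * ⟪Φ w, deriv Φ w⟫_ℂ =
      (⟪γ w, γ w⟫_ℂ)⁻¹ * ⟪γ w, deriv γ w⟫_ℂ - n * (conj w * (1 - w * conj w)⁻¹) := by
    intro w hw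
    have hd : HasDerivAt γ (deriv γ w) w := (hγ.differentiableAt (hU.mem_nhds hw)).hasDerivAt
    have h1 := ((HasWirtingerDerivAt.comp_left (hasDerivAt_pow n _)
      (hasWirtingerDerivAt_one_sub_mul_conj w)).mul
        (HasWirtingerDerivAt.inner hd hd)).congr_of_eventuallyEq (g := sectionMetric Φ) (by
          filter_upwards [hU.mem_nhds hw] with v hv using h v hv)
    have h2 := h1.wirtingerD_eq
    rw [wirtingerD_sectionMetric hU hΦ hw] at h2
    rw [h2, h w hw]
    have hq := one_sub_mul_conj_ne_zero (hU1 hw)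
    have hg : ⟪γ w, γ w⟫_ℂ ≠ 0 := inner_self_ne_zero.2 (hγ0 w hw)
    -- The power rule yields the truncated exponent `n - 1`, hence the separate case of zero.
    rcases n with _ | m
    · simp
    · simp only [Nat.add_sub_cancel]
      field_simp
      push_cast
      ring
  have hq := one_sub_mul_conj_ne_zero (hU1 hz)
  obtain ⟨a, ha⟩ := hasWirtingerDerivAt_logDeriv_metric hU hγ hz (hγ0 z hz)
  -- The z̄-derivative of n z̄ / (1 - |z|²) is n / (1 - |z|²)², which cancels the curvature of γ.
  have hb := (HasWirtingerDerivAt.const (n : ℂ)).mul (HasWirtingerDerivAt.star.mul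
    (HasWirtingerDerivAt.comp_left (f := fun w => 1 - w * conj w) (hasDerivAt_inv hq)
      (hasWirtingerDerivAt_one_sub_mul_conj z)))
  have hc := hK z hz
  rw [sectionCurvature_eq hU hγ hz (hγ0 z hz), neg_eq_iff_eq_neg] at hc
  have he := ((ha.sub hb).congr_of_eventuallyEq (g := fun w => (sectionMetric Φ w)⁻¹ *
    wirtingerD (sectionMetric Φ) w) (by
      filter_upwards [hU.mem_nhds hz] with w hw
      rw [wirtingerD_sectionMetric hU hΦ hw, sectionMetric, hlog w hw])).wirtingerDBar_eq
  have hn : (1 - (‖z‖ : ℂ) ^ 2) = 1 - z * conj z := by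
    rw [Complex.mul_conj, Complex.normSq_eq_norm_sq]
    norm_cast
  unfold sectionCurvature
  rw [he, hc, hn]
  field_simp
  ring

/-- A holomorphic function with zero curvature takes its values locally in a line. -/
theorem eventually_eq_smul_of_sectionCurvature_eq_zero [CompleteSpace E]
    {U : Set ℂ} (hU : IsOpen U) {Φ : ℂ → E} (hΦ : DifferentiableOn ℂ Φ U)
    (h0 : ∀ z ∈ U, Φ z ≠ 0) (hK : ∀ z ∈ U, sectionCurvature Φ z = 0) {z₀ : ℂ} (hz₀ : z₀ ∈ U) :
    ∀ᶠ z in 𝓝 z₀, ∃ c : ℂ, Φ z = c • Φ z₀ := by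
  -- Dividing `Φ` by its component along `Φ z₀` removes the scalar freedom; the quotient turns out
  -- to be locally constant.
  set φ : ℂ → ℂ := fun z => ⟪Φ z₀, Φ z⟫_ℂ
  have hφd : ∀ z ∈ U, HasDerivAt φ ⟪Φ z₀, deriv Φ z⟫_ℂ z := by
    intro z hz
    have h1 : HasDerivAt Φ (deriv Φ z) z := (hΦ.differentiableAt (hU.mem_nhds hz)).hasDerivAt
    exact ((innerSL ℂ (Φ z₀)).hasFDerivAt.comp_hasDerivAt z h1)
  have hφ0 : φ z₀ ≠ 0 := inner_self_ne_zero.2 (h0 z₀ hz₀)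
  have hne : ∀ᶠ z in 𝓝 z₀, φ z ≠ 0 := (hφd z₀ hz₀).continuousAt.eventually_ne hφ0
  obtain ⟨r, hr, hball⟩ := Metric.eventually_nhds_iff_ball.1 (hne.and (hU.mem_nhds hz₀))
  have hG : ∀ z ∈ Metric.ball z₀ r, HasDerivAt (fun z => (φ z)⁻¹ • Φ z) 0 z := by
    intro z hz
    obtain ⟨hz0, hzU⟩ := hball z hz
    have h1 : HasDerivAt Φ (deriv Φ z) z := (hΦ.differentiableAt (hU.mem_nhds hzU)).hasDerivAt
    have hg : ⟪Φ z, Φ z⟫_ℂ ≠ 0 := inner_self_ne_zero.2 (h0 z hzU)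
    have hgram := hK z hzU
    rw [sectionCurvature_eq hU hΦ hzU (h0 z hzU), neg_eq_zero, div_eq_zero_iff,
      or_iff_left (pow_ne_zero 2 hg)] at hgram
    -- The residual of `deriv Φ z` after projection onto `Φ z` has squared norm equal to the Gram
    -- determinant over ‖Φ z‖², which is zero.
    have hpar : deriv Φ z = (⟪Φ z, deriv Φ z⟫_ℂ / ⟪Φ z, Φ z⟫_ℂ) • Φ z := by
      rw [← sub_eq_zero, ← inner_self_eq_zero (𝕜 := ℂ)]
      simp only [inner_sub_left, inner_sub_right, inner_smul_left, inner_smul_right, map_div₀,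
        inner_conj_symm]
      field_simp
      linear_combination hgram
    refine (((hφd z hzU).inv hz0).smul h1).congr_deriv ?_
    rw [hpar, inner_smul_right, smul_smul, ← add_smul]
    convert zero_smul ℂ _
    change (φ z)⁻¹ * _ + -(_ * φ z) / φ z ^ 2 = 0
    field_simp
    ring
  filter_upwards [Metric.ball_mem_nhds z₀ hr] with z hz
  have hconst := Metric.isOpen_ball.is_const_of_deriv_eq_zero
    (convex_ball z₀ r).isPreconnected
    (fun w hw => (hG w hw).differentiableAt.differentiableWithinAt)
    (fun w hw => (hG w hw).deriv) hz (Metric.mem_ball_self hr)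
  refine ⟨φ z * (φ z₀)⁻¹, ?_⟩
  rw [mul_smul, ← hconst, smul_smul, mul_inv_cancel₀ (hball z hz).1, one_smul]

end Curvature

/-! ### The defect operator on eigenvectors. -/

section Hypercontraction

theorem pow_apply_of_apply_eq_smul {E : Type*} [NormedAddCommGroup E] [InnerProductSpace ℂ E]
    {T : E →L[ℂ] E} {x : E} {ω : ℂ} (hx : T x = ω • x) (j : ℕ) :
    (T ^ j) x = ω ^ j • x := by
  induction j with
  | zero => simp
  | succ j ih =>
    rw [pow_succ', mul_apply_eq_comp, ih, map_smul, hx, smul_smul, pow_succ]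

variable {H : Type*} [NormedAddCommGroup H] [InnerProductSpace ℂ H] [CompleteSpace H]

/-- The defect operator `∑_{j=0}^{k} (-1)^j (k choose j) (T*)^j T^j`. -/
noncomputable def defectOp (k : ℕ) (T : H →L[ℂ] H) : H →L[ℂ] H :=
  ∑ j ∈ Finset.range (k + 1),
    ((-1 : ℂ) ^ j * (k.choose j : ℂ)) • (ContinuousLinearMap.adjoint T ^ j * T ^ j)

variable {T : H →L[ℂ] H}

/-- The case k = 1 is 1 - T*T ≥ 0. The bound makes 1 - ωT* invertible on the disc. -/
theorem IsHypercontraction.norm_le_one {n : ℕ} (hT : IsHypercontraction n T) (hn : 1 ≤ n) :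
    ‖T‖ ≤ 1 := by
  refine T.opNorm_le_bound zero_le_one fun x => ?_
  have h := (hT 1 le_rfl hn).re_inner_nonneg_left x
  simp [Finset.sum_range_succ, inner_add_left, inner_neg_left,
    ContinuousLinearMap.adjoint_inner_left, inner_self_eq_norm_sq_to_K, ← Complex.ofReal_pow] at h
  nlinarith [norm_nonneg x, norm_nonneg (T x)]

/-- Replacing Tʲx by ωʲx turns the defect sum into the binomial expansion. -/
theorem defectOp_apply_of_apply_eq_smul {x : H} {ω : ℂ} (hx : T x = ω • x) (k : ℕ) :
    defectOp k T x = ((1 - ω • ContinuousLinearMap.adjoint T) ^ k) x := by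
  have hc : Commute (-(ω • ContinuousLinearMap.adjoint T)) 1 := Commute.one_right _
  rw [sub_eq_neg_add, hc.add_pow, defectOp, sum_apply,
    sum_apply]
  refine Finset.sum_congr rfl fun j _ => ?_
  rw [smul_apply, mul_apply_eq_comp,
    pow_apply_of_apply_eq_smul hx, map_smul, ← neg_smul, smul_pow, one_pow, mul_one, neg_pow,
    ← nsmul_eq_mul' (_ : H →L[ℂ] H)]
  simp only [smul_apply, smul_smul, ← Nat.cast_smul_eq_nsmul ℂ]
  congr 1
  ring

/-- Each factor, moved across the inner product, acts on the eigenvector `y` as a scalar. With x = y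
and ω = ζ this produces the weight (1 - |ω|²)ᵏ. -/
theorem inner_one_sub_smul_adjoint_pow_apply {x y : H} {ω ζ : ℂ} (hy : T y = ζ • y) (k : ℕ) :
    ⟪y, ((1 - ω • ContinuousLinearMap.adjoint T) ^ k) x⟫_ℂ =
      (1 - ω * conj ζ) ^ k * ⟪y, x⟫_ℂ := by
  induction k with
  | zero => simp
  | succ k ih =>
    rw [pow_succ', mul_apply_eq_comp, sub_apply, inner_sub_right,
      smul_apply, inner_smul_right, ContinuousLinearMap.adjoint_inner_right,
      hy, inner_smul_left, one_apply_eq_self, ih]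
    ring

theorem defectOp_apply_of_apply_eq_zero {x : H} (hx : T x = 0) (k : ℕ) :
    defectOp k T x = x := by
  rw [defectOp_apply_of_apply_eq_smul (ω := 0) (by simpa using hx)]
  simp

theorem defectOp_apply_ne_zero {x : H} (hx0 : x ≠ 0) {ω : ℂ} (hω : ω ∈ Metric.ball (0 : ℂ) 1)
    (hx : T x = ω • x) (k : ℕ) : defectOp k T x ≠ 0 := by
  intro h
  have h1 := inner_one_sub_smul_adjoint_pow_apply (x := x) (ω := ω) hx k
  rw [← defectOp_apply_of_apply_eq_smul hx, h, inner_zero_right] at h1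
  exact mul_ne_zero (pow_ne_zero k (one_sub_mul_conj_ne_zero hω)) (inner_self_ne_zero.2 hx0)
    h1.symm

end Hypercontraction

/-! ### Resolvent powers and closed invariant subspaces. -/

section AdjointInvariance

variable {H : Type*} [NormedAddCommGroup H] [InnerProductSpace ℂ H] [CompleteSpace H]

/-- The derivative of a function with values in a closed subspace lies in the subspace. -/
theorem HasDerivAt.mem_of_eventually_mem {K : Submodule ℂ H} (hK : IsClosed (K : Set H))
    {f : ℂ → H} {f' : H} {z : ℂ} (hf : HasDerivAt f f' z) (hmem : ∀ᶠ w in 𝓝 z, f w ∈ K) :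
    f' ∈ K := by
  have : CompleteSpace K := hK.completeSpace_coe
  rw [← K.orthogonal_orthogonal, Submodule.mem_orthogonal]
  intro u hu
  have h1 : HasDerivAt (fun w => ⟪u, f w⟫_ℂ) ⟪u, f'⟫_ℂ z :=
    (innerSL ℂ u).hasFDerivAt.comp_hasDerivAt z hf
  refine h1.unique ((hasDerivAt_const z (0 : ℂ)).congr_of_eventuallyEq ?_)
  filter_upwards [hmem] with w hw
  exact K.inner_left_of_mem_orthogonal hw hu

theorem isUnit_one_sub_smul {B : H →L[ℂ] H} (hB : ‖B‖ ≤ 1) {ω : ℂ}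
    (hω : ω ∈ Metric.ball (0 : ℂ) 1) : IsUnit (1 - ω • B) := by
  refine isUnit_one_sub_of_norm_lt_one ?_
  rw [norm_smul]
  have h : ‖ω‖ < 1 := by simpa using hω
  nlinarith [norm_nonneg ω, norm_nonneg B]

/-- Each differentiation in ω pulls out one factor `B`; this is how the powers of `B` are extracted
from the resolvent. -/
theorem hasDerivAt_ringInverse_one_sub_smul_pow {B : H →L[ℂ] H} {ω : ℂ}
    (h : IsUnit (1 - ω • B)) (k : ℕ) :
    HasDerivAt (fun w : ℂ => Ring.inverse (1 - w • B) ^ k)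
      ((k : ℂ) • (B * Ring.inverse (1 - ω • B) ^ (k + 1))) ω := by
  obtain ⟨u, hu⟩ := h
  have hA : HasDerivAt (fun w : ℂ => 1 - w • B) (-B) ω := by
    simpa using ((hasDerivAt_id ω).smul_const B).const_sub 1
  have hcB : Commute B (Ring.inverse (1 - ω • B)) := by
    rw [← hu, Ring.inverse_unit]
    refine Commute.units_inv_right ?_
    rw [hu]
    exact (Commute.one_right B).sub_right ((Commute.refl B).smul_right ω)
  have h1 : HasDerivAt (fun w : ℂ => Ring.inverse (1 - w • B))
      (B * Ring.inverse (1 - ω • B) ^ 2) ω := by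
    have h2 := (hasFDerivAt_ringInverse (𝕜 := ℂ) u)
    rw [hu] at h2
    refine (h2.comp_hasDerivAt ω hA).congr_deriv ?_
    rw [← hu, Ring.inverse_unit] at hcB ⊢
    simp
    rw [← hcB.eq, mul_assoc, sq]
  induction k with
  | zero => simpa using hasDerivAt_const ω (1 : H →L[ℂ] H)
  | succ k ih =>
    simp only [pow_succ _ k]
    refine (ih.mul h1).congr_deriv ?_
    rw [← mul_assoc _ B, ← (hcB.pow_right k).eq, mul_assoc, ← pow_add, smul_mul_assoc, mul_assoc,
      ← pow_succ, Nat.cast_succ, add_smul, one_smul]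

/-- If `(1 - ωB)⁻ᵐ e` lies in a closed subspace for all `ω` in the disc, then so do the vectors
`Bᵏ e`. -/
theorem pow_apply_mem_of_ringInverse_pow_apply_mem {K : Submodule ℂ H}
    (hK : IsClosed (K : Set H)) {B : H →L[ℂ] H} (hB : ‖B‖ ≤ 1) {m : ℕ} (hm : 1 ≤ m) {e : H}
    (h : ∀ ω ∈ Metric.ball (0 : ℂ) 1, (Ring.inverse (1 - ω • B) ^ m) e ∈ K) (k : ℕ) :
    (B ^ k) e ∈ K := by
  -- Up to a nonzero scalar this vector is the k-th derivative of (1 - ωB)⁻ᵐe; at ω = 0 it is Bᵏe.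
  -- The scalar gained at each step is m + k, nonzero because m ≥ 1.
  have key : ∀ ω ∈ Metric.ball (0 : ℂ) 1, (B ^ k * Ring.inverse (1 - ω • B) ^ (m + k)) e ∈ K := by
    induction k with
    | zero => simpa using h
    | succ k ih =>
      intro ω hω
      have h1 := ((hasDerivAt_ringInverse_one_sub_smul_pow
        (isUnit_one_sub_smul hB hω) (m + k)).const_mul (B ^ k)).clm_apply (hasDerivAt_const ω e)
      have h2 := h1.mem_of_eventually_mem hK (by
        filter_upwards [Metric.isOpen_ball.mem_nhds hω] with w hw using ih w hw)
      rw [map_zero, add_zero, mul_smul_comm, smul_apply, ← mul_assoc,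
        ← pow_succ] at h2
      exact (K.smul_mem_iff (Nat.cast_ne_zero.2 (by omega))).1 h2
  simpa using key 0 (by simp)

/-- If `B` is a strict contraction leaving the closed subspace `K` invariant, and
`(1 - B)ᵐ x ∈ K`, then `x ∈ K`. -/
theorem mem_of_one_sub_pow_apply_mem {K : Submodule ℂ H} (hK : IsClosed (K : Set H))
    {B : H →L[ℂ] H} (hB : ‖B‖ < 1) (hBK : Set.MapsTo B K K) {m : ℕ} {x : H}
    (h : ((1 - B) ^ m) x ∈ K) : x ∈ K := by
  induction m with
  | zero => simpa using h
  | succ m ih =>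
    refine ih ?_
    rw [pow_succ', mul_apply_eq_comp] at h
    generalize ((1 - B) ^ m) x = y at h
    have : CompleteSpace K := hK.completeSpace_coe
    obtain ⟨a, ha, b, hb, rfl⟩ := K.exists_add_mem_mem_orthogonal y
    -- As `b` is orthogonal to `K`, this forces ‖b‖² = ⟪b, Bb⟫ ≤ ‖B‖‖b‖², so b = 0.
    have h1 : b - B b ∈ K := by
      have h2 := K.sub_mem h (K.sub_mem ha (hBK ha))
      simp at h2
      convert h2 using 1
      abel
    have h3 : ⟪b, b⟫_ℂ = ⟪b, B b⟫_ℂ := by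
      rw [← sub_eq_zero, ← inner_sub_right]
      exact K.inner_left_of_mem_orthogonal h1 hb
    have h4 : ‖b‖ ^ 2 ≤ ‖B‖ * ‖b‖ ^ 2 := by
      have h5 : ‖⟪b, b⟫_ℂ‖ ≤ ‖b‖ * ‖B b‖ := h3 ▸ norm_inner_le_norm _ _
      rw [inner_self_eq_norm_sq_to_K, norm_pow] at h5
      simp at h5
      nlinarith [B.le_opNorm b, norm_nonneg b]
    have h6 : ‖b‖ = 0 := by
      by_contra h0
      have : 0 < ‖b‖ ^ 2 := by positivity
      nlinarith
    rw [norm_eq_zero.1 h6, add_zero]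
    exact ha

end AdjointInvariance

/-! ### Rigidity: from curvature to invariance under the adjoint. -/

section Rigidity

variable {H : Type*} [NormedAddCommGroup H] [InnerProductSpace ℂ H]
  {T : H →L[ℂ] H} {M : Submodule ℂ H} {hM : Set.MapsTo T M M}

theorem apply_eq_smul_of_mem_eigenKer_restrict {ω : ℂ} {x : M}
    (hx : x ∈ eigenKer (T.restrict hM) ω) : T x = ω • (x : H) := by
  have h : T.restrict hM x - ω • x = 0 := hx
  exact congrArg ((↑) : M → H) (sub_eq_zero.1 h)

theorem IsCowenDouglas.exists_eq_smul {E : Type*} [NormedAddCommGroup E] [InnerProductSpace ℂ E]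
    {Ω : Set ℂ} {S : E →L[ℂ] E} (hS : IsCowenDouglas 1 Ω S) {ω : ℂ} (hω : ω ∈ Ω) {x y : E}
    (hx : x ∈ eigenKer S ω) (hx0 : x ≠ 0) (hy : y ∈ eigenKer S ω) : ∃ c : ℂ, y = c • x := by
  have hr : Module.finrank ℂ (eigenKer S ω) = 1 := by
    rw [Module.finrank, hS.rank_ker ω hω]
    simp
  obtain ⟨c, hc⟩ := (finrank_eq_one_iff_of_nonzero' (⟨x, hx⟩ : eigenKer S ω)
    (fun h => hx0 (congrArg Subtype.val h))).1 hr ⟨y, hy⟩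
  exact ⟨c, (congrArg Subtype.val hc).symm⟩

theorem IsCowenDouglas.exists_mem_eigenKer_ne_zero {E : Type*} [NormedAddCommGroup E]
    [InnerProductSpace ℂ E] {Ω : Set ℂ} {S : E →L[ℂ] E} (hS : IsCowenDouglas 1 Ω S) {ω : ℂ}
    (hω : ω ∈ Ω) : ∃ x ∈ eigenKer S ω, x ≠ 0 := by
  apply Submodule.exists_mem_ne_zero_of_ne_bot
  intro h
  have := hS.rank_ker ω hω
  rw [h] at this
  simp at this

variable [CompleteSpace H]

/-- The image under the defect operator of a section of the eigenvector bundle takes its values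
locally in a line. -/
theorem IsHolomorphicSection.eventually_defectOp_apply_eq_smul [CompleteSpace M] {n : ℕ}
    (hn : 1 ≤ n) (hT : IsHypercontraction n T)
    (hK : IsCurvatureOn (T.restrict hM) (Metric.ball (0 : ℂ) 1)
      (fun ω => -(n : ℂ) / (1 - (‖ω‖ : ℂ) ^ 2) ^ 2))
    {U : Set ℂ} (hU : IsOpen U) (hU1 : U ⊆ Metric.ball 0 1) {γ : ℂ → M}
    (hγ : IsHolomorphicSection (T.restrict hM) U γ) {ω₀ : ℂ} (hω₀ : ω₀ ∈ U) :
    ∀ᶠ ω in 𝓝 ω₀, ∃ c : ℂ, defectOp n T (γ ω) = c • defectOp n T (γ ω₀) := by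
  obtain ⟨S, hS⟩ := CStarAlgebra.nonneg_iff_eq_star_mul_self.1
    ((ContinuousLinearMap.nonneg_iff_isPositive _).2 (hT n hn le_rfl))
  change defectOp n T = star S * S at hS
  have heig : ∀ ω ∈ U, T (γ ω) = ω • (γ ω : H) := fun ω hω =>
    apply_eq_smul_of_mem_eigenKer_restrict (hγ.mem_ker ω hω)
  have hdef : ∀ x, defectOp n T x = star S (S x) := fun x => by rw [hS, mul_apply_eq_comp]
  set Φ : ℂ → H := fun ω => S (γ ω)
  have hΦ : DifferentiableOn ℂ Φ U :=
    (S ∘L M.subtypeL).differentiable.comp_differentiableOn hγ.holomorphic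
  have hmetric : ∀ z ∈ U, ⟪Φ z, Φ z⟫_ℂ = (1 - z * conj z) ^ n * ⟪γ z, γ z⟫_ℂ := by
    intro z hz
    have h1 := inner_one_sub_smul_adjoint_pow_apply (x := (γ z : H)) (ω := z) (heig z hz) n
    rw [← defectOp_apply_of_apply_eq_smul (heig z hz), hdef, ContinuousLinearMap.star_eq_adjoint,
      ContinuousLinearMap.adjoint_inner_right] at h1
    exact h1
  have hΦ0 : ∀ z ∈ U, Φ z ≠ 0 := by
    intro z hz h0
    refine defectOp_apply_ne_zero (x := (γ z : H)) ?_ (hU1 hz) (heig z hz) n ?_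
    · simpa using hγ.ne_zero z hz
    · rw [hdef]
      change star S (Φ z) = 0
      rw [h0, map_zero]
  have hcurv := fun z (hz : z ∈ U) => sectionCurvature_eq_zero_of_metric hU hU1 hγ.holomorphic
    hγ.ne_zero hΦ hmetric (hK U γ hU hU1 hγ) hz
  filter_upwards [eventually_eq_smul_of_sectionCurvature_eq_zero hU hΦ hΦ0 hcurv hω₀]
    with ω ⟨c, hc⟩
  refine ⟨c, ?_⟩
  rw [hdef, hdef, ← map_smul]
  change (star S) (Φ ω) = (star S) (c • Φ ω₀)
  rw [hc]

/-- The defect operator maps all eigenvectors into one line. -/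
theorem defectOp_apply_mem_span [CompleteSpace M] {n : ℕ}
    (hn : 1 ≤ n) (hT : IsHypercontraction n T)
    (hB : IsCowenDouglas 1 (Metric.ball (0 : ℂ) 1) (T.restrict hM))
    (hK : IsCurvatureOn (T.restrict hM) (Metric.ball (0 : ℂ) 1)
      (fun ω => -(n : ℂ) / (1 - (‖ω‖ : ℂ) ^ 2) ^ 2)) {ω ζ : ℂ}
    (hω : ω ∈ Metric.ball (0 : ℂ) 1) (hζ : ζ ∈ Metric.ball (0 : ℂ) 1) {x y : M}
    (hx : x ∈ eigenKer (T.restrict hM) ω) (hx0 : x ≠ 0)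
    (hy : y ∈ eigenKer (T.restrict hM) ζ) (hy0 : y ≠ 0) :
    ∃ c : ℂ, defectOp n T y = c • defectOp n T x := by
  -- Proportionality is transitive and holds locally in both directions, so it spreads over the
  -- connected disc.
  let P : ℂ → ℂ → Prop := fun ω ζ => ∀ x ∈ eigenKer (T.restrict hM) ω, x ≠ 0 →
    ∀ y ∈ eigenKer (T.restrict hM) ζ, y ≠ 0 → ∃ c : ℂ, defectOp n T (y : H) = c • defectOp n T x
  suffices P ω ζ from this x hx hx0 y hy hy0
  have hloc : ∀ ω ∈ Metric.ball (0 : ℂ) 1, ∀ᶠ ζ in 𝓝[Metric.ball 0 1] ω, P ω ζ ∧ P ζ ω := by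
    intro ω hω
    obtain ⟨U, γ, hU, hU1, hωU, hγ⟩ := hB.exists_isHolomorphicSection Metric.isOpen_ball hω
    filter_upwards [nhdsWithin_le_nhds
      (hγ.eventually_defectOp_apply_eq_smul hn hT hK hU hU1 hωU),
      nhdsWithin_le_nhds (hU.mem_nhds hωU)] with ζ ⟨c, hc⟩ hζU
    have hc0 : c ≠ 0 := by
      rintro rfl
      rw [zero_smul] at hc
      exact defectOp_apply_ne_zero (by simpa using hγ.ne_zero ζ hζU) (hU1 hζU)
        (apply_eq_smul_of_mem_eigenKer_restrict (hγ.mem_ker ζ hζU)) n hc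
    have hspan : ∀ z ∈ U, ∀ x ∈ eigenKer (T.restrict hM) z, x ≠ 0 →
        ∃ a : ℂ, a ≠ 0 ∧ defectOp n T (x : H) = a • defectOp n T (γ z : H) := by
      intro z hz x hx hx0
      obtain ⟨a, rfl⟩ := hB.exists_eq_smul (hU1 hz) (hγ.mem_ker z hz) (hγ.ne_zero z hz) hx
      exact ⟨a, fun h => hx0 (by rw [h, zero_smul]), by simp⟩
    constructor
    · intro x hx hx0 y hy hy0
      obtain ⟨a, ha, hxa⟩ := hspan ω hωU x hx hx0
      obtain ⟨b, hb, hyb⟩ := hspan ζ hζU y hy hy0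
      refine ⟨b * c * a⁻¹, ?_⟩
      rw [hxa, hyb, hc, smul_smul, smul_smul, inv_mul_cancel_right₀ ha]
    · intro x hx hx0 y hy hy0
      obtain ⟨a, ha, hxa⟩ := hspan ζ hζU x hx hx0
      obtain ⟨b, hb, hyb⟩ := hspan ω hωU y hy hy0
      refine ⟨b * (a * c)⁻¹, ?_⟩
      rw [hxa, hyb, hc, smul_smul, smul_smul, mul_assoc _ a, inv_mul_cancel_right₀ (mul_ne_zero ha hc0)]
  refine (convex_ball (0 : ℂ) 1).isPreconnected.induction₂' P hloc ?_ hω hζ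
  intro u v w hu hv hw huv hvw x hx hx0 y hy hy0
  obtain ⟨q, hq, hq0⟩ : ∃ q ∈ eigenKer (T.restrict hM) v, q ≠ 0 :=
    hB.exists_mem_eigenKer_ne_zero hv
  obtain ⟨a, ha⟩ := huv x hx hx0 q hq hq0
  obtain ⟨b, hb⟩ := hvw q hq hq0 y hy hy0
  exact ⟨b * a, by rw [hb, ha, smul_smul]⟩

/-- Under the hypotheses of the rigidity theorem, `M` is invariant under the adjoint of `T`. -/
theorem mapsTo_adjoint_of_isCurvatureOn [CompleteSpace M] {n : ℕ}
    (hn : 1 ≤ n) (hT : IsHypercontraction n T)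
    (hB : IsCowenDouglas 1 (Metric.ball (0 : ℂ) 1) (T.restrict hM))
    (hK : IsCurvatureOn (T.restrict hM) (Metric.ball (0 : ℂ) 1)
      (fun ω => -(n : ℂ) / (1 - (‖ω‖ : ℂ) ^ 2) ^ 2)) :
    Set.MapsTo (ContinuousLinearMap.adjoint T) M M := by
  have h0 : (0 : ℂ) ∈ Metric.ball (0 : ℂ) 1 := by simp
  set B := ContinuousLinearMap.adjoint T with hBdef
  have hB1 : ‖B‖ ≤ 1 := by
    rw [hBdef, ContinuousLinearMap.adjoint.norm_map]
    exact hT.norm_le_one hn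
  have hMc : IsClosed (M : Set H) := (completeSpace_coe_iff_isComplete.1 ‹_›).isClosed
  have hex : ∀ ω ∈ Metric.ball (0 : ℂ) 1, ∃ q ∈ eigenKer (T.restrict hM) ω, q ≠ 0 :=
    fun ω hω => hB.exists_mem_eigenKer_ne_zero hω
  obtain ⟨e, he, he0⟩ := hex 0 h0
  have hTe : T e = 0 := by simpa using apply_eq_smul_of_mem_eigenKer_restrict he
  have hdef : ∀ ω ∈ Metric.ball (0 : ℂ) 1, ∀ x ∈ eigenKer (T.restrict hM) ω, x ≠ 0 →
      ∃ c : ℂ, c ≠ 0 ∧ ((1 - ω • B) ^ n) (x : H) = c • (e : H) := by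
    intro ω hω x hx hx0
    obtain ⟨c, hc⟩ := defectOp_apply_mem_span hn hT hB hK h0 hω he he0 hx hx0
    have hx' := apply_eq_smul_of_mem_eigenKer_restrict hx
    have hne := defectOp_apply_ne_zero (by simpa using hx0) hω hx' n
    rw [defectOp_apply_of_apply_eq_zero hTe] at hc
    refine ⟨c, ?_, by rw [← defectOp_apply_of_apply_eq_smul hx', hc]⟩
    rintro rfl
    exact hne (by rw [hc, zero_smul])
  have hpow : ∀ k, (B ^ k) (e : H) ∈ M := by
    refine fun k => pow_apply_mem_of_ringInverse_pow_apply_mem hMc hB1 hn (fun ω hω => ?_) k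
    obtain ⟨x, hx, hx0⟩ := hex ω hω
    obtain ⟨c, hc0, hc⟩ := hdef ω hω x hx hx0
    have hu := isUnit_one_sub_smul hB1 hω
    have h1 : Ring.inverse (1 - ω • B) ^ n * (1 - ω • B) ^ n = 1 := by
      rw [Ring.inverse_pow, Ring.inverse_mul_cancel _ (hu.pow n)]
    have h2 : (Ring.inverse (1 - ω • B) ^ n) (c • (e : H)) = x := by
      rw [← hc, ← mul_apply_eq_comp, h1, one_apply_eq_self]
    rw [map_smul] at h2
    exact (M.smul_mem_iff hc0).1 (h2 ▸ x.2)
  -- `K` is invariant under `B` by construction; the two inclusions identify it with `M`.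
  set K : Submodule ℂ H := (Submodule.span ℂ (Set.range fun k => (B ^ k) (e : H))).topologicalClosure
    with hKdef
  have hKc : IsClosed (K : Set H) := Submodule.isClosed_topologicalClosure _
  have hKM : K ≤ M := Submodule.topologicalClosure_minimal _
    (Submodule.span_le.2 (by rintro _ ⟨k, rfl⟩; exact hpow k)) hMc
  have hBK : Set.MapsTo B K K := by
    rw [hKdef, Submodule.topologicalClosure_coe]
    refine Set.MapsTo.closure (fun x hx => ?_) B.continuous
    have : Submodule.span ℂ (Set.range fun k => (B ^ k) (e : H)) ≤
        (Submodule.span ℂ (Set.range fun k => (B ^ k) (e : H))).comap (B : H →ₗ[ℂ] H) := by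
      refine Submodule.span_le.2 ?_
      rintro _ ⟨k, rfl⟩
      exact Submodule.subset_span ⟨k + 1, by simp [pow_succ']⟩
    exact this hx
  have hMK : M ≤ K := by
    have h1 : (⨆ ω ∈ Metric.ball (0 : ℂ) 1, eigenKer (T.restrict hM) ω) ≤
        K.comap M.subtype := by
      refine iSup₂_le fun ω hω x hx => ?_
      by_cases hx0 : x = 0
      · simp [hx0]
      obtain ⟨c, -, hc⟩ := hdef ω hω x hx hx0
      -- Here (1 - ωB)ⁿx = ce lies in `K`, and ωB is a strict contraction because |ω| < 1.
      refine mem_of_one_sub_pow_apply_mem hKc (B := ω • B) (m := n) ?_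
        (fun y hy => K.smul_mem ω (hBK hy)) ?_
      · have h : ‖ω‖ < 1 := by simpa using hω
        rw [norm_smul]
        nlinarith [norm_nonneg ω, norm_nonneg B]
      · rw [Submodule.subtype_apply, hc]
        refine K.smul_mem c (Submodule.le_topologicalClosure _ (Submodule.subset_span ⟨0, ?_⟩))
        simp
    have h2 : IsClosed ((K.comap M.subtype : Submodule ℂ M) : Set M) :=
      hKc.preimage continuous_subtype_val
    have h3 := Submodule.topologicalClosure_minimal _ h1 h2
    rw [hB.span_ker] at h3
    exact fun x hx => h3 (Submodule.mem_top (x := (⟨x, hx⟩ : M)))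
  intro x hx
  exact hKM (hBK (hMK hx))

end Rigidity

/-! ### The main theorem. -/

theorem mainTheorem2 {H : Type*} [NormedAddCommGroup H] [InnerProductSpace ℂ H] [CompleteSpace H]
    [TopologicalSpace.SeparableSpace H] (n : ℕ) (hn : 1 ≤ n)
    (T : H →L[ℂ] H) (hT : IsHypercontraction n T)
    (M : Submodule ℂ H) [CompleteSpace M] (hM : Set.MapsTo T M M)
    (hB : IsCowenDouglas 1 (Metric.ball (0 : ℂ) 1) (T.restrict hM))
    (hK : IsCurvatureOn (T.restrict hM) (Metric.ball (0 : ℂ) 1)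
      (fun ω => -(n : ℂ) / (1 - (‖ω‖ : ℂ) ^ 2) ^ 2)) :
    M.orthogonalProjectionOnto ∘L T ∘L Mᗮ.subtypeL = 0 ∧ Reduces T M ∧
      (M ≠ ⊤ → IsReducible T) := by
  have hadj := mapsTo_adjoint_of_isCurvatureOn hn hT hB hK
  have horth : Set.MapsTo T Mᗮ Mᗮ := by
    intro x hx
    refine (M.mem_orthogonal _).2 fun u hu => ?_
    rw [← ContinuousLinearMap.adjoint_inner_left]
    exact M.inner_right_of_mem_orthogonal (hadj hu) hx
  have hred : Reduces T M :=
    ⟨(completeSpace_coe_iff_isComplete.1 ‹_›).isClosed, hM, horth⟩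
  refine ⟨?_, hred, fun htop => ⟨M, ?_, htop, hred⟩⟩
  · ext x
    simpa [Submodule.starProjection_apply_eq_zero_iff] using horth x.2
  -- M is nonzero because it contains an eigenvector for ω = 0.
  · rintro rfl
    obtain ⟨x, -, hx⟩ := hB.exists_mem_eigenKer_ne_zero (ω := 0) (by simp)
    exact hx (Subsingleton.elim _ _)
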